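/- Let $0\le\alpha<1$ and let $m,N\ge 1$ be integers. Let $\mathcal S^*(\alpha)$ be the class of starlike functions of order $\alpha$: analytic functions $f(z)=z+\sum_{n\ge2}a_nz^n$ on the unit disk $\mathbb D=\{|z|<1\}$ with $\operatorname{Re}\bigl(zf'(z)/f(z)\bigr)>\alpha$ on $\mathbb D$; put $a_1=1$ and $\Omega=f(\mathbb D)$, and let $d(0,\partial\Omega)$ be the Euclidean distance from $0$ to the boundary of $\Omega$. Then the equation $$\frac{r^m}{(1-r^m)^{2(1-\alpha)}}+A(r)+\sum_{n=\max\{N,2\}}^{\infty}\ \prod_{k=0}^{n-2}\frac{k+2(1-\alpha)}{k+1}\,r^n-\frac1{4^{1-\alpha}}=0,\qquad A(r)=\begin{cases}r,&N=1,\\0,&N\ge2,\end{cases}$$ has a smallest root $r_0$ in $(0,1)$, and for every $f\in\mathcal S^*(\alpha)$ $$|f(z^m)|+\sum_{n=N}^{\infty}|a_n||z|^n\le d(0,\partial\Omega)\qquad\text{whenever } |z|\le r_0 .$$ The radius $r_0$ is sharp: there is an $f\in\mathcal S^*(\alpha)$ for which equality holds at some $z$ with $|z|=r_0$, and for which, for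 every $r\in(r_0,1)$, the inequality fails at some $z$ with $|z|=r$. -/

import Mathlib

open Metric Set

noncomputable section

/-- The class `𝒮*(α)`: functions `f` analytic in the open unit disk, normalized by `f 0 = 0` and
`f' 0 = 1`, with `Re (z f'(z) / f(z)) > α` in the disk. At `z = 0` the quotient has a removable
singularity with value `1`, so the condition is imposed off the origin, where it presupposes
`f z ≠ 0`. -/
structure IsStarlikeOfOrder (α : ℝ) (f : ℂ → ℂ) : Prop where
  differentiableOn : DifferentiableOn ℂ f (ball 0 1)
  map_zero : f 0 = 0
  deriv_zero : deriv f 0 = 1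
  ne_zero : ∀ z ∈ ball (0 : ℂ) 1, z ≠ 0 → f z ≠ 0
  lt_re : ∀ z ∈ ball (0 : ℂ) 1, z ≠ 0 → α < (z * deriv f z / f z).re

/-- The `n`-th Taylor coefficient of `f` at the origin. -/
def taylorCoeff (f : ℂ → ℂ) (n : ℕ) : ℂ :=
  iteratedDeriv n f 0 / (n.factorial : ℂ)

/-- The Bohr–Rogosinski sum `|f(z^m)| + ∑_{n ≥ N} |a_n| |z|^n`. -/
def bohrRogosinskiSum (f : ℂ → ℂ) (m N : ℕ) (z : ℂ) : ℝ :=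
  ‖f (z ^ m)‖ + ∑' j : ℕ, ‖taylorCoeff f (N + j)‖ * ‖z‖ ^ (N + j)

/-- The Euclidean distance from `0` to the boundary of `Ω = f(𝔻)`. -/
def distToBoundary (f : ℂ → ℂ) : ℝ :=
  infDist 0 (frontier (f '' ball (0 : ℂ) 1))

/-- `∏_{k=0}^{n-2} (k + 2(1-α)) / (k+1)`, used for `n ≥ 2`. -/
def starlikeCoeffBound (α : ℝ) (n : ℕ) : ℝ :=
  ∏ k ∈ Finset.range (n - 1), ((k : ℝ) + 2 * (1 - α)) / ((k : ℝ) + 1)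

/-- The left-hand side of the equation for the radius, for `0 < r < 1`. The term of index `n = 1`
(present only for `N = 1`) is `A(r) = r`; the product formula is used for the indices `n ≥ 2`,
so the series runs over `n ≥ max N 2`. -/
def radiusEquation (α : ℝ) (m N : ℕ) (r : ℝ) : ℝ :=
  r ^ m / (1 - r ^ m) ^ (2 * (1 - α))
    + (if N = 1 then r else 0)
    + ∑' j : ℕ, starlikeCoeffBound α (max N 2 + j) * r ^ (max N 2 + j)
    - 1 / (4 : ℝ) ^ (1 - α)

end

/-! Write `f z = z * exp (g z)`, so that `z f' / f = 1 + z g'` has real part larger than `α`.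

Carathéodory's inequality gives `|q_i| ≤ 2 (1 - α)` for the coefficients of `q = g'`. Since
`φ = exp ∘ g` solves `φ' = q φ`, its coefficients satisfy `(n + 1) φ_{n+1} = ∑ q_i φ_{n-i}`, a
recursion that the products in the statement satisfy with equality for `q_i = 2 (1 - α)`. This
bounds both terms of the Bohr–Rogosinski sum.

Harnack's inequality for `Re (1 + z g')`, integrated along a radius, gives
`|f z| ≥ |z| / (1 + |z|) ^ (2 (1 - α))`, which tends to `4 ^ (-(1 - α))` at the boundary. For this
to bound `d(0, ∂Ω)` the boundary must be nonempty: for `α ≥ 0` the map `ζ ↦ ζ + g (exp ζ)`, whose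
exponential is `f (exp ζ)`, has a derivative of positive real part on the left half-plane, so `f`
is univalent by the Noshiro–Warschawski theorem, and an inverse of `f` defined on all of `ℂ` would
be a bounded entire function.

For `z / (1 - z) ^ (2 (1 - α))` the upper bounds are attained on the positive axis and the lower
bound at the boundary point `-1`. Hence `r₀` is where the strictly increasing majorant of the sums
reaches `4 ^ (-(1 - α))`.
-/

section TaylorCoeff

open Filter Topology

variable {f g φ q : ℂ → ℂ}

theorem taylorCoeff_zero (f : ℂ → ℂ) : taylorCoeff f 0 = f 0 := by
  simp [taylorCoeff]

theorem taylorCoeff_congr (h : f =ᶠ[𝓝 0] g) (n : ℕ) : taylorCoeff f n = taylorCoeff g n := by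
  rw [taylorCoeff, taylorCoeff, (h.iteratedDeriv n).eq_of_nhds]

theorem taylorCoeff_deriv (f : ℂ → ℂ) (n : ℕ) :
    taylorCoeff (deriv f) n = (n + 1) * taylorCoeff f (n + 1) := by
  have hfac : (n.factorial : ℂ) ≠ 0 := by exact_mod_cast n.factorial_ne_zero
  have hsucc : (n : ℂ) + 1 ≠ 0 := n.cast_add_one_ne_zero
  rw [taylorCoeff, taylorCoeff, iteratedDeriv_succ', Nat.factorial_succ]
  push_cast
  field_simp

theorem taylorCoeff_mul (hf : AnalyticAt ℂ f 0) (hg : AnalyticAt ℂ g 0) (n : ℕ) :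
    taylorCoeff (fun z => f z * g z) n =
      ∑ i ∈ Finset.range (n + 1), taylorCoeff f i * taylorCoeff g (n - i) := by
  have hleibniz : iteratedDeriv n (fun z => f z * g z) 0 = _ :=
    iteratedDeriv_mul (n := n) hf.contDiffAt hg.contDiffAt
  rw [taylorCoeff, hleibniz, Finset.sum_div]
  refine Finset.sum_congr rfl fun i hi => ?_
  have hfac : (n.factorial : ℂ) ≠ 0 := by exact_mod_cast n.factorial_ne_zero
  rw [Nat.cast_choose ℂ (Finset.mem_range_succ_iff.1 hi), taylorCoeff, taylorCoeff]
  field_simp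

theorem taylorCoeff_id_mul_succ (hf : AnalyticAt ℂ f 0) (n : ℕ) :
    taylorCoeff (fun z => z * f z) (n + 1) = taylorCoeff f n := by
  have hid : ∀ i ≠ 1, taylorCoeff (fun z => z) i = 0 := by
    rintro (_ | _ | i) hi
    · simp [taylorCoeff]
    · exact absurd rfl hi
    · simp [taylorCoeff, iteratedDeriv_succ']
  rw [taylorCoeff_mul (f := fun z => z) analyticAt_id hf, Finset.sum_eq_single 1]
  · simp [taylorCoeff]
  · exact fun i _ hi => by rw [hid i hi, zero_mul]
  · simp

theorem taylorCoeff_const_add_succ (c : ℂ) (f : ℂ → ℂ) (n : ℕ) :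
    taylorCoeff (fun z => c + f z) (n + 1) = taylorCoeff f (n + 1) := by
  rw [taylorCoeff, taylorCoeff, iteratedDeriv_const_add n.succ_pos]

theorem taylorCoeff_div_one_sub (c : ℂ) (n : ℕ) :
    taylorCoeff (fun z => c / (1 - z)) n = c := by
  have han : AnalyticAt ℂ (fun z : ℂ => c / (1 - z)) 0 :=
    analyticAt_const.div (analyticAt_const.sub analyticAt_id) (by simp)
  have hgeom : (fun z => c / (1 - z)) =ᶠ[𝓝 0] fun z => c + z * (c / (1 - z)) := by
    filter_upwards [eventually_ne_nhds (zero_ne_one' ℂ)] with z hz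
    field_simp [sub_ne_zero.2 hz.symm]
    ring
  induction n with
  | zero => simp [taylorCoeff_zero]
  | succ n ih => rw [taylorCoeff_congr hgeom, taylorCoeff_const_add_succ,
      taylorCoeff_id_mul_succ han, ih]

theorem succ_mul_taylorCoeff_of_deriv_eq (hφ : AnalyticAt ℂ φ 0) (hq : AnalyticAt ℂ q 0)
    (hd : deriv φ =ᶠ[𝓝 0] fun z => q z * φ z) (n : ℕ) :
    (n + 1) * taylorCoeff φ (n + 1) =
      ∑ i ∈ Finset.range (n + 1), taylorCoeff q i * taylorCoeff φ (n - i) := by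
  rw [← taylorCoeff_deriv, taylorCoeff_congr hd, taylorCoeff_mul hq hφ]

theorem hasSum_taylorCoeff (hf : DifferentiableOn ℂ f (ball 0 1)) {z : ℂ}
    (hz : z ∈ ball (0 : ℂ) 1) : HasSum (fun n => taylorCoeff f n * z ^ n) (f z) := by
  refine (Complex.hasSum_taylorSeries_on_ball hf hz).congr_fun fun n => ?_
  simp only [taylorCoeff, sub_zero, smul_eq_mul]
  ring

end TaylorCoeff

section PositiveRealPart

open ComplexConjugate Filter Topology Real

theorem norm_circleAverage_le {E : Type*} [NormedAddCommGroup E] [NormedSpace ℝ E] (f : ℂ → E)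
    (c : ℂ) (R : ℝ) : ‖circleAverage f c R‖ ≤ circleAverage (fun z => ‖f z‖) c R := by
  rw [circleAverage, circleAverage, norm_smul, smul_eq_mul, Real.norm_of_nonneg (by positivity)]
  gcongr
  exact intervalIntegral.norm_integral_le_integral_norm (by positivity)

variable {p : ℂ → ℂ} {r : ℝ} {n : ℕ}

theorem sphere_abs_subset_ball (hr0 : 0 < r) (hr1 : r < 1) : sphere (0 : ℂ) |r| ⊆ ball 0 1 := by
  rw [abs_of_pos hr0]
  exact sphere_subset_closedBall.trans (closedBall_subset_ball hr1)

theorem ne_zero_of_mem_sphere_abs (hr0 : 0 < r) {z : ℂ} (hz : z ∈ sphere (0 : ℂ) |r|) : z ≠ 0 :=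
  ne_of_mem_sphere hz (abs_pos.2 hr0.ne').ne'

theorem circleIntegrable_div_pow (hp : ContinuousOn p (sphere 0 |r|)) (hr0 : 0 < r) (n : ℕ) :
    CircleIntegrable (fun z => p z / z ^ n) 0 r :=
  (hp.div (by fun_prop) fun _ hz => pow_ne_zero n
    (ne_zero_of_mem_sphere_abs hr0 hz)).circleIntegrable'

theorem circleAverage_eq_apply_zero (hp : DifferentiableOn ℂ p (ball 0 1)) (hr0 : 0 < r)
    (hr1 : r < 1) : circleAverage p 0 r = p 0 := by
  refine DiffContOnCl.circleAverage ?_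
  rw [abs_of_pos hr0]
  exact (hp.mono (closedBall_subset_ball hr1)).diffContOnCl_ball subset_rfl

theorem taylorCoeff_eq_circleAverage (hp : DifferentiableOn ℂ p (ball 0 1)) (n : ℕ) (hr0 : 0 < r)
    (hr1 : r < 1) : taylorCoeff p n = circleAverage (fun z => p z / z ^ n) 0 r := by
  have hcl : DiffContOnCl ℂ p (ball 0 r) :=
    (hp.mono (closedBall_subset_ball hr1)).diffContOnCl_ball subset_rfl
  have hcauchy := hcl.circleIntegral_one_div_sub_center_pow_smul hr0 n
  have hintegrand : (∮ z in C(0, r), (z - 0)⁻¹ • (p z / z ^ n)) =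
      ∮ z in C(0, r), (1 / (z - 0) ^ (n + 1)) • p z := by
    refine circleIntegral.integral_congr hr0.le fun z hz => ?_
    have hz0 : z ≠ 0 := ne_of_mem_sphere hz hr0.ne'
    simp only [sub_zero, smul_eq_mul]
    field_simp
    ring
  rw [circleAverage_eq_circleIntegral hr0.ne', hintegrand, hcauchy, taylorCoeff, smul_smul,
    inv_mul_eq_div, div_div_cancel_left' Complex.two_pi_I_ne_zero, smul_eq_mul, inv_mul_eq_div]

theorem circleAverage_conj_div_pow_eq_zero (hp : DifferentiableOn ℂ p (ball 0 1)) (hn : n ≠ 0)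
    (hr0 : 0 < r) (hr1 : r < 1) : circleAverage (fun z => conj (p z) / z ^ n) 0 r = 0 := by
  have hmul : DifferentiableOn ℂ (fun z => z ^ n * p z) (ball 0 1) := by fun_prop
  have hvanish : circleAverage (fun z => conj (z ^ n * p z)) 0 r = 0 := by
    have hint : CircleIntegrable (fun z => z ^ n * p z) 0 r :=
      (hmul.continuousOn.mono (sphere_abs_subset_ball hr0 hr1)).circleIntegrable'
    refine (Complex.conjCLE.toContinuousLinearMap.circleAverage_comp_comm hint).trans ?_
    simp [circleAverage_eq_apply_zero hmul hr0 hr1, hn]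
  have hsphere : ∀ z ∈ sphere (0 : ℂ) |r|,
      conj (p z) / z ^ n = ((r : ℂ) ^ (2 * n))⁻¹ • conj (z ^ n * p z) := by
    intro z hz
    have hz0 := ne_zero_of_mem_sphere_abs hr0 hz
    have hrne : (r : ℂ) ≠ 0 := by exact_mod_cast hr0.ne'
    have hconj : conj z = r ^ 2 / z := by
      rw [eq_div_iff hz0, Complex.conj_mul', mem_sphere_zero_iff_norm.1 hz, abs_of_pos hr0]
    rw [map_mul, map_pow, hconj, smul_eq_mul, div_pow, ← pow_mul]
    field_simp
  rw [circleAverage_congr_sphere hsphere, circleAverage_fun_smul, hvanish, smul_zero]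

theorem taylorCoeff_eq_circleAverage_re (hp : DifferentiableOn ℂ p (ball 0 1)) (hn : n ≠ 0)
    (hr0 : 0 < r) (hr1 : r < 1) :
    taylorCoeff p n = circleAverage (fun z => ((2 * (p z).re : ℝ) : ℂ) / z ^ n) 0 r := by
  have hcont := hp.continuousOn.mono (sphere_abs_subset_ball hr0 hr1)
  have hadd := circleAverage_fun_add (circleIntegrable_div_pow hcont hr0 n)
    (circleIntegrable_div_pow (p := fun z => conj (p z))
      (Complex.continuous_conj.comp_continuousOn hcont) hr0 n)
  rw [circleAverage_conj_div_pow_eq_zero hp hn hr0 hr1, add_zero,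
    ← taylorCoeff_eq_circleAverage hp n hr0 hr1] at hadd
  simp only [← hadd, ← Complex.add_conj, add_div]

theorem norm_taylorCoeff_mul_pow_le_of_re_nonneg (hp : DifferentiableOn ℂ p (ball 0 1))
    (hre : ∀ z ∈ ball (0 : ℂ) 1, 0 ≤ (p z).re) (hn : n ≠ 0) (hr0 : 0 < r) (hr1 : r < 1) :
    ‖taylorCoeff p n‖ * r ^ n ≤ 2 * (p 0).re := by
  have hsph := sphere_abs_subset_ball hr0 hr1
  have hnorm : ∀ z ∈ sphere (0 : ℂ) |r|,
      ‖((2 * (p z).re : ℝ) : ℂ) / z ^ n‖ = (2 / r ^ n) • (p z).re := by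
    intro z hz
    rw [norm_div, norm_pow, mem_sphere_zero_iff_norm.1 hz, abs_of_pos hr0, Complex.norm_real,
      Real.norm_of_nonneg (by linarith [hre z (hsph hz)]), smul_eq_mul]
    ring
  have hmean : circleAverage (fun z => (p z).re) 0 r = (p 0).re := by
    have hint : CircleIntegrable p 0 r := (hp.continuousOn.mono hsph).circleIntegrable'
    refine (Complex.reCLM.circleAverage_comp_comm hint).trans ?_
    rw [circleAverage_eq_apply_zero hp hr0 hr1, Complex.reCLM_apply]
  rw [← le_div_iff₀ (pow_pos hr0 n)]
  calc ‖taylorCoeff p n‖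
      ≤ circleAverage (fun z => ‖((2 * (p z).re : ℝ) : ℂ) / z ^ n‖) 0 r := by
        rw [taylorCoeff_eq_circleAverage_re hp hn hr0 hr1]
        exact norm_circleAverage_le _ 0 r
    _ = 2 / r ^ n * (p 0).re := by
        rw [circleAverage_congr_sphere hnorm, circleAverage_fun_smul, hmean, smul_eq_mul]
    _ = 2 * (p 0).re / r ^ n := by ring

theorem norm_taylorCoeff_le_of_re_nonneg (hp : DifferentiableOn ℂ p (ball 0 1))
    (hre : ∀ z ∈ ball (0 : ℂ) 1, 0 ≤ (p z).re) (hn : n ≠ 0) :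
    ‖taylorCoeff p n‖ ≤ 2 * (p 0).re := by
  have hcont : Continuous fun r : ℝ => ‖taylorCoeff p n‖ * r ^ n := by fun_prop
  have hlim : Tendsto (fun r : ℝ => ‖taylorCoeff p n‖ * r ^ n) (𝓝[<] 1)
      (𝓝 ‖taylorCoeff p n‖) := by
    simpa using hcont.continuousWithinAt.tendsto (s := Iio 1) (x := 1)
  refine le_of_tendsto hlim ?_
  filter_upwards [Ioo_mem_nhdsLT one_pos] with r hr
  exact norm_taylorCoeff_mul_pow_le_of_re_nonneg hp hre hn hr.1 hr.2

theorem re_mul_one_sub_le_of_norm_sub_le {w c : ℂ} {t : ℝ} (ht0 : 0 ≤ t) (ht1 : t ≤ 1)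
    (hre : 0 ≤ w.re + c.re) (h : ‖w - c‖ ≤ t * ‖w + conj c‖) :
    c.re * (1 - t) ≤ w.re * (1 + t) := by
  have hsq : ‖w - c‖ ^ 2 ≤ t ^ 2 * ‖w + conj c‖ ^ 2 := by
    rw [← mul_pow]
    gcongr
  simp only [← Complex.normSq_eq_norm_sq, Complex.normSq_apply, Complex.add_re, Complex.add_im,
    Complex.sub_re, Complex.sub_im, Complex.conj_re, Complex.conj_im] at hsq
  have him : 0 ≤ (1 - t ^ 2) * (w.im - c.im) ^ 2 :=
    mul_nonneg (sub_nonneg.2 (pow_le_one₀ ht0 ht1)) (sq_nonneg _)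
  have habs : |w.re - c.re| ≤ t * (w.re + c.re) :=
    abs_le_of_sq_le_sq (by linarith) (mul_nonneg ht0 hre)
  linarith [(abs_le.1 habs).1]

theorem mul_one_sub_div_one_add_le_re (hp : DifferentiableOn ℂ p (ball 0 1))
    (hre : ∀ z ∈ ball (0 : ℂ) 1, 0 ≤ (p z).re) {z : ℂ} (hz : z ∈ ball (0 : ℂ) 1) :
    (p 0).re * ((1 - ‖z‖) / (1 + ‖z‖)) ≤ (p z).re := by
  rcases (hre 0 (mem_ball_self one_pos)).eq_or_lt with h0 | h0
  · rw [← h0, zero_mul]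
    exact hre z hz
  have hdenom : ∀ z ∈ ball (0 : ℂ) 1, p z + conj (p 0) ≠ 0 := by
    intro z hz h
    have hsum : (p z).re + (p 0).re = 0 := by simpa using congrArg Complex.re h
    linarith [hre z hz]
  have hnormSq : ∀ z, Complex.normSq (p z + conj (p 0)) =
      Complex.normSq (p z - p 0) + 4 * ((p z).re * (p 0).re) := by
    intro z
    simp only [Complex.normSq_apply, Complex.add_re, Complex.add_im, Complex.sub_re,
      Complex.sub_im, Complex.conj_re, Complex.conj_im]
    ring
  -- Schwarz's lemma applies to the Cayley transform of `p`.
  have hmaps : MapsTo (fun z => (p z - p 0) / (p z + conj (p 0))) (ball 0 1) (closedBall 0 1) := by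
    intro z hz
    rw [mem_closedBall_zero_iff, norm_div, div_le_one (norm_pos_iff.2 (hdenom z hz)),
      ← sq_le_sq₀ (norm_nonneg _) (norm_nonneg _), ← Complex.normSq_eq_norm_sq,
      ← Complex.normSq_eq_norm_sq, hnormSq]
    linarith [mul_nonneg (hre z hz) h0.le]
  have hz1 : ‖z‖ < 1 := mem_ball_zero_iff.1 hz
  have hschwarz : ‖(p z - p 0) / (p z + conj (p 0))‖ ≤ ‖z‖ :=
    Complex.norm_le_norm_of_mapsTo_ball ((hp.sub_const _).div (hp.add_const _) hdenom) hmaps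
      (by simp) hz1
  rw [norm_div, div_le_iff₀ (norm_pos_iff.2 (hdenom z hz))] at hschwarz
  rw [mul_div_assoc', div_le_iff₀ (by positivity)]
  exact re_mul_one_sub_le_of_norm_sub_le (norm_nonneg z) hz1.le (by linarith [hre z hz]) hschwarz

theorem neg_two_mul_div_one_add_norm_le_re {v : ℂ → ℂ} {c : ℝ}
    (hv : DifferentiableOn ℂ v (ball 0 1)) (hv0 : v 0 = 0)
    (hre : ∀ z ∈ ball (0 : ℂ) 1, -c ≤ (v z).re) {z : ℂ} (hz : z ∈ ball (0 : ℂ) 1) :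
    -(2 * c * (‖z‖ / (1 + ‖z‖))) ≤ (v z).re := by
  have hharnack := mul_one_sub_div_one_add_le_re (p := fun z => v z + c) (hv.add_const _)
    (fun z hz => by simpa using neg_le_iff_add_nonneg.1 (hre z hz)) hz
  have hratio : (1 - ‖z‖) / (1 + ‖z‖) = 1 - 2 * (‖z‖ / (1 + ‖z‖)) := by
    field_simp
    ring
  simp only [hv0, zero_add, Complex.add_re, Complex.ofReal_re, hratio] at hharnack
  linarith

theorem re_sub_mul_log_one_add_norm_le {g : ℂ → ℂ} {c : ℝ} (hg : DifferentiableOn ℂ g (ball 0 1))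
    (hre : ∀ z ∈ ball (0 : ℂ) 1, -c ≤ (z * deriv g z).re) {z : ℂ} (hz : z ∈ ball (0 : ℂ) 1) :
    (g 0).re - 2 * c * Real.log (1 + ‖z‖) ≤ (g z).re := by
  have hmem : ∀ t ∈ Icc (0 : ℝ) 1, (t : ℂ) * z ∈ ball (0 : ℂ) 1 := fun t ht => by
    simpa using (convex_ball (0 : ℂ) 1).smul_mem_of_zero_mem (mem_ball_self one_pos) hz ht
  have hpos : ∀ t ∈ Icc (0 : ℝ) 1, 0 < 1 + t * ‖z‖ := fun t ht => by
    linarith [mul_nonneg ht.1 (norm_nonneg z)]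
  have hharnack : ∀ t ∈ Icc (0 : ℝ) 1,
      0 ≤ t * ((deriv g (t * z) * z).re + 2 * c * (‖z‖ / (1 + t * ‖z‖))) := by
    intro t ht
    have h := neg_two_mul_div_one_add_norm_le_re (differentiableOn_id.mul (hg.deriv isOpen_ball))
      (zero_mul _) hre (hmem t ht)
    simp only [mul_assoc, Pi.mul_apply, Complex.re_ofReal_mul, norm_mul, Complex.norm_real,
      Real.norm_of_nonneg ht.1, mul_div_assoc, mul_comm z] at h
    linarith
  have hder : ∀ t ∈ Icc (0 : ℝ) 1, HasDerivAt
      (fun t : ℝ => (g (t * z)).re + 2 * c * Real.log (1 + t * ‖z‖))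
      ((deriv g (t * z) * z).re + 2 * c * (‖z‖ / (1 + t * ‖z‖))) t := by
    intro t ht
    have hgt := (hg.differentiableAt (isOpen_ball.mem_nhds (hmem t ht))).hasDerivAt
    have hlin : HasDerivAt (fun t : ℝ => 1 + t * ‖z‖) ‖z‖ t :=
      (hasDerivAt_mul_const ‖z‖).const_add 1
    exact (hgt.comp (t : ℂ) (hasDerivAt_mul_const z)).real_of_complex.add
      ((hlin.log (hpos t ht).ne').const_mul _)
  have hmono : MonotoneOn
      (fun t : ℝ => (g (t * z)).re + 2 * c * Real.log (1 + t * ‖z‖)) (Icc 0 1) := by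
    refine monotoneOn_of_hasDerivWithinAt_nonneg (convex_Icc 0 1)
      (fun t ht => (hder t ht).continuousAt.continuousWithinAt)
      (fun t ht => (hder t (interior_subset ht)).hasDerivWithinAt) fun t ht => ?_
    exact nonneg_of_mul_nonneg_right (hharnack t (interior_subset ht)) (interior_Icc.subset ht).1
  have hends := hmono (left_mem_Icc.2 zero_le_one) (right_mem_Icc.2 zero_le_one) zero_le_one
  simp only [Complex.ofReal_zero, zero_mul, add_zero, Real.log_one, mul_zero, Complex.ofReal_one,
    one_mul] at hends
  linarith

end PositiveRealPart

section Representation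

open Filter Topology

variable {f g : ℂ → ℂ} {α : ℝ}

theorem exists_differentiableOn_eq_exp {φ : ℂ → ℂ} {c : ℂ} {R : ℝ}
    (hφ : DifferentiableOn ℂ φ (ball c R)) (hne : ∀ z ∈ ball c R, φ z ≠ 0) :
    ∃ g : ℂ → ℂ, DifferentiableOn ℂ g (ball c R) ∧ g c = Complex.log (φ c) ∧
      ∀ z ∈ ball c R, φ z = Complex.exp (g z) := by
  have hquot : DifferentiableOn ℂ (fun z => deriv φ z / φ z) (ball c R) :=
    (hφ.deriv isOpen_ball).div hφ hne
  obtain ⟨g, hgc, hg⟩ := hquot.isExactOn_ball.with_val_at c (Complex.log (φ c))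
  refine ⟨g, fun z hz => (hg z hz).differentiableAt.differentiableWithinAt, hgc, fun z hz => ?_⟩
  have hder : ∀ z ∈ ball c R, HasDerivAt (fun z => φ z * Complex.exp (-g z)) 0 z := by
    intro z hz
    have hφz := (hφ.differentiableAt (isOpen_ball.mem_nhds hz)).hasDerivAt
    refine (hφz.fun_mul (hg z hz).fun_neg.cexp).congr_deriv ?_
    field_simp [hne z hz]
    ring
  have hc : c ∈ ball c R := mem_ball_self (dist_nonneg.trans_lt hz)
  have hconst : φ z * Complex.exp (-g z) = φ c * Complex.exp (-g c) :=
    isOpen_ball.is_const_of_deriv_eq_zero (convex_ball c R).isPreconnected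
      (fun z hz => (hder z hz).differentiableAt.differentiableWithinAt)
      (fun z hz => (hder z hz).deriv) hz hc
  rw [hgc, Complex.exp_neg (Complex.log _), Complex.exp_log (hne c hc),
    mul_inv_cancel₀ (hne c hc)] at hconst
  rw [eq_inv_of_mul_eq_one_left hconst, Complex.exp_neg, inv_inv]

theorem lt_re_of_eventually_ne {p : ℂ → ℂ} {z₀ : ℂ} {a : ℝ} (hp : AnalyticAt ℂ p z₀)
    (h : ∀ᶠ z in 𝓝[≠] z₀, a < (p z).re) : a < (p z₀).re := by
  rcases hp.eventually_constant_or_nhds_le_map_nhds with hconst | hopen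
  · obtain ⟨z, hz, hpz⟩ := (h.and (hconst.filter_mono nhdsWithin_le_nhds)).exists
    rwa [← hpz]
  · by_contra! hle
    have hmin : ∀ᶠ z in 𝓝 z₀, (p z₀).re ≤ (p z).re := by
      filter_upwards [eventually_nhdsWithin_iff.1 h] with z hz
      rcases eq_or_ne z z₀ with rfl | hne
      · exact le_rfl
      · exact hle.trans (hz hne).le
    have hre : ∀ᶠ x in 𝓝 (p z₀).re, (p z₀).re ≤ x :=
      Complex.isOpenMap_re.nhds_le _ (eventually_map.2 (hopen (eventually_map.2 hmin)))
    obtain ⟨x, hxlt, hx⟩ := ((hre.filter_mono nhdsWithin_le_nhds).and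
      (self_mem_nhdsWithin : ∀ᶠ x in 𝓝[<] (p z₀).re, x < (p z₀).re)).exists
    exact hx.not_ge hxlt

theorem hasDerivAt_of_eq_mul_exp (hg : DifferentiableOn ℂ g (ball 0 1))
    (hfg : ∀ z ∈ ball (0 : ℂ) 1, f z = z * Complex.exp (g z)) {z : ℂ} (hz : z ∈ ball (0 : ℂ) 1) :
    HasDerivAt f ((1 + z * deriv g z) * Complex.exp (g z)) z := by
  have hgz := (hg.differentiableAt (isOpen_ball.mem_nhds hz)).hasDerivAt
  refine HasDerivAt.congr_of_eventuallyEq ?_ (eventually_of_mem (isOpen_ball.mem_nhds hz) hfg)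
  exact ((hasDerivAt_id' z).fun_mul hgz.cexp).congr_deriv (by ring)

theorem mul_deriv_div_of_eq_mul_exp (hg : DifferentiableOn ℂ g (ball 0 1))
    (hfg : ∀ z ∈ ball (0 : ℂ) 1, f z = z * Complex.exp (g z)) {z : ℂ} (hz : z ∈ ball (0 : ℂ) 1)
    (hz0 : z ≠ 0) : z * deriv f z / f z = 1 + z * deriv g z := by
  rw [(hasDerivAt_of_eq_mul_exp hg hfg hz).deriv, hfg z hz]
  field_simp [Complex.exp_ne_zero]

theorem IsStarlikeOfOrder.exists_eq_mul_exp (hf : IsStarlikeOfOrder α f) :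
    ∃ g : ℂ → ℂ, DifferentiableOn ℂ g (ball 0 1) ∧ g 0 = 0 ∧
      (∀ z ∈ ball (0 : ℂ) 1, f z = z * Complex.exp (g z)) ∧
      ∀ z ∈ ball (0 : ℂ) 1, α < (1 + z * deriv g z).re := by
  have hball : ball (0 : ℂ) 1 ∈ 𝓝 0 := ball_mem_nhds 0 one_pos
  have hφ : DifferentiableOn ℂ (dslope f 0) (ball 0 1) :=
    (Complex.differentiableOn_dslope hball).2 hf.differentiableOn
  have hfφ : ∀ z, f z = z * dslope f 0 z := fun z => by
    simpa [hf.map_zero] using (sub_smul_dslope f 0 z).symm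
  have hφ0 : dslope f 0 0 = 1 := by rw [dslope_same, hf.deriv_zero]
  have hφne : ∀ z ∈ ball (0 : ℂ) 1, dslope f 0 z ≠ 0 := by
    intro z hz
    rcases eq_or_ne z 0 with rfl | hz0
    · exact hφ0.symm ▸ one_ne_zero
    · exact right_ne_zero_of_mul (hfφ z ▸ hf.ne_zero z hz hz0)
  obtain ⟨g, hg, hg0, hexp⟩ := exists_differentiableOn_eq_exp hφ hφne
  have hfg : ∀ z ∈ ball (0 : ℂ) 1, f z = z * Complex.exp (g z) := fun z hz => by
    rw [hfφ, hexp z hz]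
  have hre : ∀ z ∈ ball (0 : ℂ) 1, z ≠ 0 → α < (1 + z * deriv g z).re := fun z hz hz0 => by
    simpa only [mul_deriv_div_of_eq_mul_exp hg hfg hz hz0] using hf.lt_re z hz hz0
  refine ⟨g, hg, by rw [hg0, hφ0, Complex.log_one], hfg, fun z hz => ?_⟩
  rcases eq_or_ne z 0 with rfl | hz0
  · have hq : DifferentiableOn ℂ (fun z => 1 + z * deriv g z) (ball 0 1) :=
      (differentiableOn_id.mul (hg.deriv isOpen_ball)).const_add 1
    exact lt_re_of_eventually_ne (p := fun z => 1 + z * deriv g z) (hq.analyticAt hball)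
      (eventually_nhdsWithin_iff.2 (eventually_of_mem hball hre))
  · exact hre z hz hz0

theorem isStarlikeOfOrder_of_eq_mul_exp (hg : DifferentiableOn ℂ g (ball 0 1)) (hg0 : g 0 = 0)
    (hfg : ∀ z ∈ ball (0 : ℂ) 1, f z = z * Complex.exp (g z))
    (hre : ∀ z ∈ ball (0 : ℂ) 1, α < (1 + z * deriv g z).re) : IsStarlikeOfOrder α f := by
  have hzero : (0 : ℂ) ∈ ball (0 : ℂ) 1 := mem_ball_self one_pos
  constructor
  case differentiableOn =>
    exact fun z hz =>
      (hasDerivAt_of_eq_mul_exp hg hfg hz).differentiableAt.differentiableWithinAt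
  case map_zero => rw [hfg 0 hzero, zero_mul]
  case deriv_zero => simp [(hasDerivAt_of_eq_mul_exp hg hfg hzero).deriv, hg0]
  case ne_zero =>
    exact fun z hz hz0 => by simpa only [hfg z hz] using mul_ne_zero hz0 (Complex.exp_ne_zero _)
  case lt_re =>
    exact fun z hz hz0 => by
      simpa only [mul_deriv_div_of_eq_mul_exp hg hfg hz hz0] using hre z hz

theorem IsStarlikeOfOrder.lt_one (hf : IsStarlikeOfOrder α f) : α < 1 := by
  obtain ⟨g, -, -, -, hre⟩ := hf.exists_eq_mul_exp
  simpa using hre 0 (mem_ball_self one_pos)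

theorem IsStarlikeOfOrder.mono {β : ℝ} (hf : IsStarlikeOfOrder α f) (hβ : β ≤ α) :
    IsStarlikeOfOrder β f :=
  { hf with lt_re := fun z hz hz0 => hβ.trans_lt (hf.lt_re z hz hz0) }

theorem IsStarlikeOfOrder.deriv_ne_zero (hf : IsStarlikeOfOrder 0 f) {z : ℂ}
    (hz : z ∈ ball (0 : ℂ) 1) : deriv f z ≠ 0 := by
  intro hderiv
  rcases eq_or_ne z 0 with rfl | hz0
  · exact one_ne_zero (hf.deriv_zero.symm.trans hderiv)
  · simpa [hderiv] using hf.lt_re z hz hz0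

end Representation

section Univalence

open Filter Topology

theorem injOn_of_convex_of_re_deriv_pos {s : Set ℂ} (hs : Convex ℝ s) {h h' : ℂ → ℂ}
    (hd : ∀ z ∈ s, HasDerivAt h (h' z) z) (hre : ∀ z ∈ s, 0 < (h' z).re) : InjOn h s := by
  intro a ha b hb hab
  by_contra hne
  have hba : b - a ≠ 0 := sub_ne_zero.2 (Ne.symm hne)
  have hmem : ∀ t ∈ Icc (0 : ℝ) 1, a + (t : ℂ) * (b - a) ∈ s := fun t ht => by
    simpa using hs.add_smul_sub_mem ha hb ht
  have hder : ∀ t ∈ Icc (0 : ℝ) 1, HasDerivAt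
      (fun t : ℝ => (h (a + t * (b - a)) / (b - a)).re) (h' (a + t * (b - a))).re t := by
    intro t ht
    have hseg : HasDerivAt (fun w : ℂ => a + w * (b - a)) (b - a) t :=
      (hasDerivAt_mul_const (b - a)).const_add a
    have hcomp := (((hd _ (hmem t ht)).comp (t : ℂ) hseg).div_const (b - a)).real_of_complex
    rwa [mul_div_cancel_right₀ _ hba] at hcomp
  have hmono : StrictMonoOn (fun t : ℝ => (h (a + t * (b - a)) / (b - a)).re) (Icc 0 1) :=
    strictMonoOn_of_hasDerivWithinAt_pos (convex_Icc 0 1)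
      (fun t ht => (hder t ht).continuousAt.continuousWithinAt)
      (fun t ht => (hder t (interior_subset ht)).hasDerivWithinAt)
      fun t ht => hre _ (hmem t (interior_subset ht))
  simpa [hab] using hmono (left_mem_Icc.2 zero_le_one) (right_mem_Icc.2 zero_le_one) zero_lt_one

theorem exp_mem_ball_zero_one {ζ : ℂ} : Complex.exp ζ ∈ ball (0 : ℂ) 1 ↔ ζ.re < 0 := by
  rw [mem_ball_zero_iff, Complex.norm_exp, Real.exp_lt_one_iff]

theorem injOn_add_comp_exp {g : ℂ → ℂ} (hg : DifferentiableOn ℂ g (ball 0 1))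
    (hre : ∀ z ∈ ball (0 : ℂ) 1, 0 < (1 + z * deriv g z).re) :
    InjOn (fun ζ => ζ + g (Complex.exp ζ)) {ζ : ℂ | ζ.re < 0} := by
  refine injOn_of_convex_of_re_deriv_pos (convex_halfSpace_re_lt 0)
    (h' := fun ζ => 1 + Complex.exp ζ * deriv g (Complex.exp ζ)) (fun ζ hζ => ?_)
    fun ζ hζ => hre _ (exp_mem_ball_zero_one.2 hζ)
  have hgexp := (hg.differentiableAt
    (isOpen_ball.mem_nhds (exp_mem_ball_zero_one.2 hζ))).hasDerivAt
  exact ((hasDerivAt_id' ζ).fun_add (hgexp.comp ζ (Complex.hasDerivAt_exp ζ))).congr_deriv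
    (by ring)

theorem injOn_mul_exp {g : ℂ → ℂ} (hg : DifferentiableOn ℂ g (ball 0 1))
    (hre : ∀ z ∈ ball (0 : ℂ) 1, 0 < (1 + z * deriv g z).re) :
    InjOn (fun z => z * Complex.exp (g z)) (ball 0 1) := by
  intro a ha b hb (hab : a * Complex.exp (g a) = b * Complex.exp (g b))
  rcases eq_or_ne a 0 with rfl | ha0
  · simpa [Complex.exp_ne_zero, eq_comm] using hab
  have hb0 : b ≠ 0 := by
    rintro rfl
    simp [ha0, Complex.exp_ne_zero] at hab
  obtain ⟨ζ, rfl⟩ : ∃ ζ, Complex.exp ζ = a := ⟨_, Complex.exp_log ha0⟩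
  obtain ⟨ω, rfl⟩ : ∃ ω, Complex.exp ω = b := ⟨_, Complex.exp_log hb0⟩
  rw [← Complex.exp_add, ← Complex.exp_add, Complex.exp_eq_exp_iff_exists_int] at hab
  obtain ⟨k, hk⟩ := hab
  have hperiod : Complex.exp (ω + k * (2 * Real.pi * Complex.I)) = Complex.exp ω :=
    Complex.exp_periodic.int_mul k ω
  rw [← hperiod] at hb ⊢
  refine congrArg Complex.exp (injOn_add_comp_exp hg hre (exp_mem_ball_zero_one.1 ha)
    (exp_mem_ball_zero_one.1 hb) ?_)
  simp only [hperiod, hk]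
  ring

theorem IsStarlikeOfOrder.injOn {f : ℂ → ℂ} (hf : IsStarlikeOfOrder 0 f) :
    InjOn f (ball 0 1) := by
  obtain ⟨g, hg, -, hfg, hre⟩ := hf.exists_eq_mul_exp
  exact (injOn_mul_exp hg hre).congr fun z hz => (hfg z hz).symm

variable {f : ℂ → ℂ} {U : Set ℂ}

theorem isOpen_image_of_injOn (hU : IsOpen U) (hU' : IsPreconnected U)
    (hf : DifferentiableOn ℂ f U) (hinj : InjOn f U) {s : Set ℂ} (hsU : s ⊆ U) (hs : IsOpen s) :
    IsOpen (f '' s) := by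
  rcases s.eq_empty_or_nonempty with rfl | ⟨a, ha⟩
  · simp
  rcases (hf.analyticOnNhd hU).is_constant_or_isOpen hU' with ⟨w, hw⟩ | hopen
  · obtain ⟨b, hb, hba⟩ := (infinite_of_mem_nhds a (hs.mem_nhds ha)).nontrivial.exists_ne a
    exact absurd (hinj (hsU hb) (hsU ha) ((hw b (hsU hb)).trans (hw a (hsU ha)).symm)) hba
  · exact hopen s hsU hs

theorem image_ne_univ_of_injOn (hU : IsOpen U) (hU' : IsPreconnected U)
    (hbdd : Bornology.IsBounded U) (hf : DifferentiableOn ℂ f U) (hinj : InjOn f U)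
    (hderiv : ∀ z ∈ U, deriv f z ≠ 0) : f '' U ≠ univ := by
  intro huniv
  have hsurj : ∀ w, ∃ z ∈ U, f z = w := fun w => huniv.superset (mem_univ w)
  choose k hkU hfk using hsurj
  have hcont : Continuous k := by
    refine continuous_def.2 fun V hV => ?_
    have hpre : k ⁻¹' V = f '' (V ∩ U) := by
      ext w
      constructor
      · exact fun hw => ⟨k w, ⟨hw, hkU w⟩, hfk w⟩
      · rintro ⟨z, ⟨hzV, hzU⟩, rfl⟩
        rwa [mem_preimage, hinj (hkU _) hzU (hfk _)]
    rw [hpre]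
    exact isOpen_image_of_injOn hU hU' hf hinj inter_subset_right (hV.inter hU)
  have hentire : Differentiable ℂ k := fun w =>
    ((hf.differentiableAt (hU.mem_nhds (hkU w))).hasDerivAt.of_local_left_inverse
      hcont.continuousAt (hderiv _ (hkU w)) (Eventually.of_forall hfk)).differentiableAt
  have hconst := hentire.apply_eq_apply_of_bounded (hbdd.subset (range_subset_iff.2 hkU)) 0 1
  exact zero_ne_one ((hfk 0).symm.trans ((congrArg f hconst).trans (hfk 1)))

end Univalence

section Growth

variable {f : ℂ → ℂ} {α : ℝ} {z : ℂ}

/-- The function `x ↦ x / (1 - x) ^ (2 (1 - α))` governing the growth of the class `𝒮*(α)`: for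
`|z| = r` the values `|f z|` lie between `-starlikeGrowth α (-r)` and `starlikeGrowth α r`. -/
noncomputable def starlikeGrowth (α x : ℝ) : ℝ :=
  x / (1 - x) ^ (2 * (1 - α))

theorem starlikeGrowth_eq_mul_exp (α : ℝ) {x : ℝ} (hx : x < 1) :
    starlikeGrowth α x = x * Real.exp (-(2 * (1 - α) * Real.log (1 - x))) := by
  rw [starlikeGrowth, Real.rpow_def_of_pos (sub_pos.2 hx), Real.exp_neg, div_eq_mul_inv,
    mul_comm (Real.log _)]

theorem starlikeGrowth_neg_one (α : ℝ) : starlikeGrowth α (-1) = -(1 / 4 ^ (1 - α)) := by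
  rw [starlikeGrowth, sub_neg_eq_add, one_add_one_eq_two, Real.rpow_mul zero_le_two, neg_div]
  norm_num

theorem continuousOn_starlikeGrowth (α : ℝ) : ContinuousOn (starlikeGrowth α) (Iio 1) := by
  have hpos : ∀ x ∈ Iio (1 : ℝ), 0 < 1 - x := fun x hx => sub_pos.2 hx
  exact continuousOn_id.div ((continuousOn_const.sub continuousOn_id).rpow_const
    fun x hx => Or.inl (hpos x hx).ne') fun x hx => (Real.rpow_pos_of_pos (hpos x hx) _).ne'

theorem strictMonoOn_starlikeGrowth (hα : α < 1) : StrictMonoOn (starlikeGrowth α) (Ico 0 1) := by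
  intro s _ t ht hst
  exact div_lt_div₀ hst (Real.rpow_le_rpow (by linarith [ht.2]) (by linarith) (by linarith)) ht.1
    (Real.rpow_pos_of_pos (by linarith [ht.2]) _)

theorem le_starlikeGrowth (hα : α < 1) {x : ℝ} (hx : x ∈ Ico (0 : ℝ) 1) :
    x ≤ starlikeGrowth α x :=
  le_div_self hx.1 (Real.rpow_pos_of_pos (by linarith [hx.2]) _)
    (Real.rpow_le_one (by linarith [hx.2]) (by linarith [hx.1]) (by linarith))

theorem IsStarlikeOfOrder.neg_starlikeGrowth_neg_norm_le (hf : IsStarlikeOfOrder α f)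
    (hz : z ∈ ball (0 : ℂ) 1) : -starlikeGrowth α (-‖z‖) ≤ ‖f z‖ := by
  obtain ⟨g, hg, hg0, hfg, hre⟩ := hf.exists_eq_mul_exp
  have hre' : ∀ z ∈ ball (0 : ℂ) 1, -(1 - α) ≤ (z * deriv g z).re := fun z hz => by
    have h := hre z hz
    rw [Complex.add_re, Complex.one_re] at h
    linarith
  have hlower := re_sub_mul_log_one_add_norm_le hg hre' hz
  rw [hg0, Complex.zero_re, zero_sub] at hlower
  rw [starlikeGrowth_eq_mul_exp α (by linarith [norm_nonneg z]), neg_mul, neg_neg, sub_neg_eq_add,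
    hfg z hz, norm_mul, Complex.norm_exp]
  gcongr

end Growth

section Coefficients

open Filter Topology

variable {f g : ℂ → ℂ} {α : ℝ} {n : ℕ}

theorem starlikeCoeffBound_one (α : ℝ) : starlikeCoeffBound α 1 = 1 := by
  simp [starlikeCoeffBound]

theorem starlikeCoeffBound_nonneg (hα : α ≤ 1) (n : ℕ) : 0 ≤ starlikeCoeffBound α n :=
  Finset.prod_nonneg fun k _ => div_nonneg
    (add_nonneg k.cast_nonneg (mul_nonneg zero_le_two (sub_nonneg.2 hα))) k.cast_add_one_pos.le

theorem succ_mul_starlikeCoeffBound_add_two (α : ℝ) (n : ℕ) :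
    (n + 1) * starlikeCoeffBound α (n + 2) = (n + 2 * (1 - α)) * starlikeCoeffBound α (n + 1) := by
  simp only [starlikeCoeffBound, Nat.add_sub_cancel, Nat.add_succ_sub_one,
    Finset.prod_range_succ]
  field_simp

theorem succ_mul_starlikeCoeffBound_add_two_eq_sum (α : ℝ) (n : ℕ) :
    (n + 1) * starlikeCoeffBound α (n + 2) =
      ∑ i ∈ Finset.range (n + 1), 2 * (1 - α) * starlikeCoeffBound α (n - i + 1) := by
  induction n with
  | zero => simp [starlikeCoeffBound]
  | succ n ih =>
    have hrec := succ_mul_starlikeCoeffBound_add_two α (n + 1)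
    rw [Finset.sum_range_succ']
    simp only [Nat.add_sub_add_right, Nat.sub_zero, ← ih]
    push_cast at hrec ⊢
    linarith

theorem succ_mul_taylorCoeff_of_eq_mul_exp (hg : DifferentiableOn ℂ g (ball 0 1))
    (hfg : ∀ z ∈ ball (0 : ℂ) 1, f z = z * Complex.exp (g z)) (n : ℕ) :
    (n + 1) * taylorCoeff f (n + 2) =
      ∑ i ∈ Finset.range (n + 1), taylorCoeff (deriv g) i * taylorCoeff f (n - i + 1) := by
  have hball : ball (0 : ℂ) 1 ∈ 𝓝 0 := ball_mem_nhds 0 one_pos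
  have han : AnalyticAt ℂ g 0 := hg.analyticAt hball
  have hshift : ∀ k, taylorCoeff f (k + 1) = taylorCoeff (fun z => Complex.exp (g z)) k :=
    fun k => (taylorCoeff_congr (eventually_of_mem hball hfg) _).trans
      (taylorCoeff_id_mul_succ han.cexp k)
  simp only [hshift]
  refine succ_mul_taylorCoeff_of_deriv_eq han.cexp han.deriv ?_ n
  filter_upwards [hball] with z hz
  exact (hg.differentiableAt (isOpen_ball.mem_nhds hz)).hasDerivAt.cexp.deriv.trans (mul_comm _ _)

theorem norm_taylorCoeff_deriv_le (hg : DifferentiableOn ℂ g (ball 0 1))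
    (hre : ∀ z ∈ ball (0 : ℂ) 1, α < (1 + z * deriv g z).re) (n : ℕ) :
    ‖taylorCoeff (deriv g) n‖ ≤ 2 * (1 - α) := by
  have hg' : DifferentiableOn ℂ (deriv g) (ball 0 1) := hg.deriv isOpen_ball
  have hcoeff := norm_taylorCoeff_le_of_re_nonneg
    (p := fun z => ((1 - α : ℝ) : ℂ) + z * deriv g z) (n := n + 1) (by fun_prop)
    (fun z hz => ?_) n.succ_ne_zero
  · rwa [taylorCoeff_const_add_succ,
      taylorCoeff_id_mul_succ (hg'.analyticAt (ball_mem_nhds 0 one_pos)), zero_mul, add_zero,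
      Complex.ofReal_re] at hcoeff
  · have h := hre z hz
    rw [Complex.add_re, Complex.one_re] at h
    rw [Complex.add_re, Complex.ofReal_re]
    linarith

theorem IsStarlikeOfOrder.taylorCoeff_one (hf : IsStarlikeOfOrder α f) : taylorCoeff f 1 = 1 := by
  simp [taylorCoeff, hf.deriv_zero]

theorem IsStarlikeOfOrder.norm_taylorCoeff_le (hf : IsStarlikeOfOrder α f) (hn : n ≠ 0) :
    ‖taylorCoeff f n‖ ≤ starlikeCoeffBound α n := by
  obtain ⟨g, hg, -, hfg, hre⟩ := hf.exists_eq_mul_exp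
  induction n using Nat.strong_induction_on with
  | _ n ih =>
    rcases n with _ | _ | n
    · contradiction
    · simp [hf.taylorCoeff_one, starlikeCoeffBound_one]
    have hsucc : ‖(n : ℂ) + 1‖ = n + 1 := by exact_mod_cast Complex.norm_natCast (n + 1)
    refine le_of_mul_le_mul_left ?_ (n.cast_add_one_pos (α := ℝ))
    calc (n + 1) * ‖taylorCoeff f (n + 2)‖ = ‖(n + 1) * taylorCoeff f (n + 2)‖ := by
          rw [norm_mul, hsucc]
      _ ≤ ∑ i ∈ Finset.range (n + 1), 2 * (1 - α) * starlikeCoeffBound α (n - i + 1) := by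
          rw [succ_mul_taylorCoeff_of_eq_mul_exp hg hfg]
          refine norm_sum_le_of_le _ fun i _ => ?_
          rw [norm_mul]
          gcongr
          · linarith [hf.lt_one]
          · exact norm_taylorCoeff_deriv_le hg hre i
          · exact ih _ (by omega) (Nat.succ_ne_zero _)
      _ = (n + 1) * starlikeCoeffBound α (n + 2) :=
          (succ_mul_starlikeCoeffBound_add_two_eq_sum α n).symm

end Coefficients

section Boundary

open Filter Topology

theorem le_norm_of_mem_frontier_image {E F : Type*} [SeminormedAddCommGroup E] [ProperSpace E]
    [NormedAddCommGroup F] {f : E → F} {R : ℝ} {ψ : ℝ → ℝ} (hf : ContinuousOn f (ball 0 R))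
    (hopen : IsOpen (f '' ball 0 R)) (hψ : ContinuousOn ψ (Icc 0 R))
    (hle : ∀ z ∈ ball 0 R, ψ ‖z‖ ≤ ‖f z‖) {w : F} (hw : w ∈ frontier (f '' ball 0 R)) :
    ψ R ≤ ‖w‖ := by
  rw [hopen.frontier_eq] at hw
  obtain ⟨x, hx, hxw⟩ := mem_closure_iff_seq_limit.1 hw.1
  choose z hz hzx using hx
  obtain ⟨a, ha, k, hk, hka⟩ := (isCompact_closedBall (0 : E) R).tendsto_subseq
    fun n => ball_subset_closedBall (hz n)
  have hlim : Tendsto (fun n => f (z (k n))) atTop (𝓝 w) :=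
    (hxw.comp hk.tendsto_atTop).congr fun n => (hzx (k n)).symm
  have ha_notMem : a ∉ ball 0 R := fun hmem => hw.2 ⟨a, hmem, tendsto_nhds_unique
    ((hf.continuousAt (isOpen_ball.mem_nhds hmem)).tendsto.comp hka) hlim⟩
  have haR : ‖a‖ = R := le_antisymm (mem_closedBall_zero_iff.1 ha)
    (not_lt.1 fun h => ha_notMem (mem_ball_zero_iff.2 h))
  have hnorm : Tendsto (fun n => ‖z (k n)‖) atTop (𝓝[Icc 0 R] R) :=
    tendsto_nhdsWithin_iff.2 ⟨haR ▸ hka.norm,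
      Eventually.of_forall fun n => ⟨norm_nonneg _, (mem_ball_zero_iff.1 (hz (k n))).le⟩⟩
  have hR : R ∈ Icc 0 R := ⟨haR ▸ norm_nonneg a, le_rfl⟩
  exact le_of_tendsto_of_tendsto' ((hψ R hR).tendsto.comp hnorm) hlim.norm
    fun n => hle _ (hz (k n))

theorem mem_frontier_image_of_tendsto {X Y ι : Type*} [TopologicalSpace X] [T2Space X]
    [TopologicalSpace Y] {f : X → Y} {U : Set X} (hU : IsOpen U) (hinj : InjOn f U)
    (hopen : ∀ s ⊆ U, IsOpen s → IsOpen (f '' s)) {l : Filter ι} [l.NeBot] {z : ι → X} {a : X}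
    {w : Y} (hz : ∀ᶠ i in l, z i ∈ U) (ha : a ∉ U) (hza : Tendsto z l (𝓝 a))
    (hw : Tendsto (fun i => f (z i)) l (𝓝 w)) : w ∈ frontier (f '' U) := by
  rw [(hopen U subset_rfl hU).frontier_eq]
  refine ⟨mem_closure_of_tendsto hw (hz.mono fun i => mem_image_of_mem f), ?_⟩
  rintro ⟨b, hb, rfl⟩
  obtain ⟨V, W, hV, hW, haV, hbW, hVW⟩ := t2_separation (ne_of_mem_of_not_mem hb ha).symm
  have himage : f '' (W ∩ U) ∈ 𝓝 (f b) :=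
    (hopen _ inter_subset_right (hW.inter hU)).mem_nhds (mem_image_of_mem f ⟨hbW, hb⟩)
  obtain ⟨i, hiU, ⟨c, ⟨hcW, hcU⟩, hci⟩, hiV⟩ :=
    (hz.and ((hw.eventually himage).and (hza.eventually (hV.mem_nhds haV)))).exists
  exact disjoint_left.1 hVW hiV (hinj hcU hiU hci ▸ hcW)

variable {f : ℂ → ℂ} {α : ℝ}

theorem IsStarlikeOfOrder.isOpen_image (hf : IsStarlikeOfOrder 0 f) {s : Set ℂ}
    (hs : s ⊆ ball 0 1) (hs' : IsOpen s) : IsOpen (f '' s) :=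
  isOpen_image_of_injOn isOpen_ball (convex_ball 0 1).isPreconnected hf.differentiableOn hf.injOn
    hs hs'

theorem IsStarlikeOfOrder.frontier_image_nonempty (hf : IsStarlikeOfOrder 0 f) :
    (frontier (f '' ball 0 1)).Nonempty :=
  nonempty_frontier_iff.2 ⟨(nonempty_ball.2 one_pos).image f,
    image_ne_univ_of_injOn isOpen_ball (convex_ball 0 1).isPreconnected isBounded_ball
      hf.differentiableOn hf.injOn fun _ => hf.deriv_ne_zero⟩

theorem IsStarlikeOfOrder.le_distToBoundary (hα : 0 ≤ α) (hf : IsStarlikeOfOrder α f) :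
    1 / (4 : ℝ) ^ (1 - α) ≤ distToBoundary f := by
  have hf₀ := hf.mono hα
  have hψ : ContinuousOn (fun x => -starlikeGrowth α (-x)) (Icc 0 1) :=
    ((continuousOn_starlikeGrowth α).comp continuousOn_neg fun x hx => by
      simp only [mem_Iio]; linarith [hx.1]).neg
  refine (le_infDist hf₀.frontier_image_nonempty).2 fun w hw => ?_
  have hnorm := le_norm_of_mem_frontier_image hf.differentiableOn.continuousOn
    (hf₀.isOpen_image subset_rfl isOpen_ball) hψ (fun z => hf.neg_starlikeGrowth_neg_norm_le) hw
  rwa [starlikeGrowth_neg_one, neg_neg, ← dist_zero_left] at hnorm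

end Boundary

section Extremal

open Filter Topology

variable {α : ℝ} {n : ℕ} {z : ℂ}

/-- The extremal function `z / (1 - z) ^ (2 (1 - α))` of the class `𝒮*(α)`, with the principal
branch of the power; for `α = 0` it is the Koebe function. -/
noncomputable def starlikeExtremal (α : ℝ) (z : ℂ) : ℂ :=
  z / (1 - z) ^ ((2 * (1 - α) : ℝ) : ℂ)

theorem half_lt_re_inv_one_sub (hz : z ∈ ball (0 : ℂ) 1) : 1 / 2 < (1 - z)⁻¹.re := by
  have hz1 : Complex.normSq z < 1 := by
    rw [Complex.normSq_eq_norm_sq]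
    exact pow_lt_one₀ (norm_nonneg z) (mem_ball_zero_iff.1 hz) two_ne_zero
  have hne : 1 - z ≠ 0 := sub_ne_zero.2 fun h => by simp [← h] at hz1
  rw [Complex.inv_re, div_lt_div_iff₀ two_pos (Complex.normSq_pos.2 hne)]
  simp only [Complex.normSq_apply, Complex.sub_re, Complex.sub_im, Complex.one_re,
    Complex.one_im] at hz1 ⊢
  linarith

theorem one_sub_mem_slitPlane (hz : z ∈ ball (0 : ℂ) 1) : 1 - z ∈ Complex.slitPlane := by
  simpa [sub_eq_add_neg] using
    Complex.mem_slitPlane_of_norm_lt_one (z := -z) (by simpa using hz)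

theorem starlikeExtremal_eq_mul_exp (α : ℝ) (hz : z ∈ ball (0 : ℂ) 1) :
    starlikeExtremal α z =
      z * Complex.exp (-(((2 * (1 - α) : ℝ) : ℂ) * Complex.log (1 - z))) := by
  rw [starlikeExtremal, Complex.cpow_def_of_ne_zero
    (Complex.slitPlane_ne_zero (one_sub_mem_slitPlane hz)), Complex.exp_neg, div_eq_mul_inv,
    mul_comm (Complex.log _)]

theorem hasDerivAt_neg_mul_log_one_sub (c : ℂ) (hz : z ∈ ball (0 : ℂ) 1) :
    HasDerivAt (fun z => -(c * Complex.log (1 - z))) (c / (1 - z)) z := by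
  have hlog := ((hasDerivAt_id' z).const_sub 1).clog (one_sub_mem_slitPlane hz)
  exact (hlog.const_mul c).fun_neg.congr_deriv (by ring)

theorem differentiableOn_neg_mul_log_one_sub (c : ℂ) :
    DifferentiableOn ℂ (fun z => -(c * Complex.log (1 - z))) (ball 0 1) := fun _ hz =>
  (hasDerivAt_neg_mul_log_one_sub c hz).differentiableAt.differentiableWithinAt

theorem taylorCoeff_deriv_neg_mul_log_one_sub (c : ℂ) (n : ℕ) :
    taylorCoeff (deriv fun z => -(c * Complex.log (1 - z))) n = c := by
  refine (taylorCoeff_congr ?_ n).trans (taylorCoeff_div_one_sub c n)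
  exact eventually_of_mem (ball_mem_nhds 0 one_pos) fun z hz =>
    (hasDerivAt_neg_mul_log_one_sub c hz).deriv

theorem isStarlikeOfOrder_starlikeExtremal (hα : α < 1) :
    IsStarlikeOfOrder α (starlikeExtremal α) := by
  refine isStarlikeOfOrder_of_eq_mul_exp (differentiableOn_neg_mul_log_one_sub _) (by simp)
    (fun z hz => starlikeExtremal_eq_mul_exp α hz) fun z hz => ?_
  have hne : 1 - z ≠ 0 := Complex.slitPlane_ne_zero (one_sub_mem_slitPlane hz)
  have hquot : 1 + z * (((2 * (1 - α) : ℝ) : ℂ) / (1 - z)) =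
      ((1 - 2 * (1 - α) : ℝ) : ℂ) + ((2 * (1 - α) : ℝ) : ℂ) * (1 - z)⁻¹ := by
    push_cast
    field_simp
    ring
  rw [(hasDerivAt_neg_mul_log_one_sub _ hz).deriv, hquot, Complex.add_re, Complex.ofReal_re,
    Complex.re_ofReal_mul]
  linarith [mul_lt_mul_of_pos_left (half_lt_re_inv_one_sub hz) (sub_pos.2 hα)]

theorem starlikeExtremal_ofReal (α : ℝ) {x : ℝ} (hx : x < 1) :
    starlikeExtremal α x = starlikeGrowth α x := by
  rw [starlikeExtremal, starlikeGrowth, ← Complex.ofReal_one, ← Complex.ofReal_sub,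
    ← Complex.ofReal_cpow (sub_pos.2 hx).le, Complex.ofReal_div]

theorem taylorCoeff_starlikeExtremal (hα : α < 1) (hn : n ≠ 0) :
    taylorCoeff (starlikeExtremal α) n = starlikeCoeffBound α n := by
  induction n using Nat.strong_induction_on with
  | _ n ih =>
    rcases n with _ | _ | n
    · contradiction
    · rw [(isStarlikeOfOrder_starlikeExtremal hα).taylorCoeff_one, starlikeCoeffBound_one,
        Complex.ofReal_one]
    have hrec := succ_mul_taylorCoeff_of_eq_mul_exp (f := starlikeExtremal α)
      (differentiableOn_neg_mul_log_one_sub _) (fun z hz => starlikeExtremal_eq_mul_exp α hz) n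
    refine mul_left_cancel₀ (n.cast_add_one_ne_zero (R := ℂ)) ?_
    calc (n + 1) * taylorCoeff (starlikeExtremal α) (n + 2)
        = ∑ i ∈ Finset.range (n + 1),
            ((2 * (1 - α) : ℝ) : ℂ) * starlikeCoeffBound α (n - i + 1) := by
          rw [hrec]
          refine Finset.sum_congr rfl fun i _ => ?_
          rw [taylorCoeff_deriv_neg_mul_log_one_sub, ih _ (by omega) (Nat.succ_ne_zero _)]
      _ = (n + 1) * starlikeCoeffBound α (n + 2) := by
          exact_mod_cast (succ_mul_starlikeCoeffBound_add_two_eq_sum α n).symm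

theorem distToBoundary_starlikeExtremal (hα0 : 0 ≤ α) (hα1 : α < 1) :
    distToBoundary (starlikeExtremal α) = 1 / (4 : ℝ) ^ (1 - α) := by
  have hf := isStarlikeOfOrder_starlikeExtremal hα1
  have hf₀ := hf.mono hα0
  refine le_antisymm ?_ (hf.le_distToBoundary hα0)
  have hmem : ((starlikeGrowth α (-1) : ℝ) : ℂ) ∈ frontier (starlikeExtremal α '' ball 0 1) := by
    have hdisk : ∀ᶠ x : ℝ in 𝓝[>] (-1), x ∈ Ioo (-1 : ℝ) 1 := Ioo_mem_nhdsGT (by norm_num)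
    have hgrowth : Tendsto (starlikeGrowth α) (𝓝[>] (-1)) (𝓝 (starlikeGrowth α (-1))) :=
      ((continuousOn_starlikeGrowth α).continuousAt
        (Iio_mem_nhds (by norm_num))).tendsto.mono_left nhdsWithin_le_nhds
    refine mem_frontier_image_of_tendsto (l := 𝓝[>] (-1 : ℝ)) (z := fun x : ℝ => (x : ℂ))
      (a := ((-1 : ℝ) : ℂ)) isOpen_ball hf₀.injOn (fun s => hf₀.isOpen_image)
      (hdisk.mono fun x hx => ?_) (by simp)
      (Complex.continuous_ofReal.continuousAt.tendsto.mono_left nhdsWithin_le_nhds)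
      (((Complex.continuous_ofReal.tendsto _).comp hgrowth).congr'
        (hdisk.mono fun x hx => (starlikeExtremal_ofReal α hx.2).symm))
    simpa [abs_lt] using hx
  refine (infDist_le_dist_of_mem hmem).trans_eq ?_
  rw [dist_zero_left, Complex.norm_real, starlikeGrowth_neg_one, norm_neg,
    Real.norm_of_nonneg (by positivity)]

end Extremal

section Majorant

variable {f : ℂ → ℂ} {α r : ℝ} {m N : ℕ} {z : ℂ}

theorem hasSum_starlikeCoeffBound (hα : α < 1) (hr : r ∈ Ico (0 : ℝ) 1) :
    HasSum (fun n => starlikeCoeffBound α (n + 1) * r ^ (n + 1)) (starlikeGrowth α r) := by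
  have hf := isStarlikeOfOrder_starlikeExtremal hα
  have hsum := hasSum_taylorCoeff hf.differentiableOn (z := (r : ℂ))
    (by simpa [abs_of_nonneg hr.1] using hr.2)
  rw [← hasSum_nat_add_iff' 1, starlikeExtremal_ofReal α hr.2] at hsum
  simp only [taylorCoeff_starlikeExtremal hα (Nat.succ_ne_zero _), Finset.range_one,
    Finset.sum_singleton, taylorCoeff_zero, hf.map_zero, zero_mul, sub_zero] at hsum
  exact_mod_cast hsum

theorem hasSum_starlikeCoeffBound_add (hα : α < 1) (hN : N ≠ 0) (hr : r ∈ Ico (0 : ℝ) 1) :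
    HasSum (fun j => starlikeCoeffBound α (N + j) * r ^ (N + j)) (starlikeGrowth α r -
      ∑ i ∈ Finset.range (N - 1), starlikeCoeffBound α (i + 1) * r ^ (i + 1)) := by
  refine ((hasSum_nat_add_iff' (N - 1)).2 (hasSum_starlikeCoeffBound hα hr)).congr_fun fun j => ?_
  rw [show j + (N - 1) + 1 = N + j by omega]

theorem IsStarlikeOfOrder.norm_le (hf : IsStarlikeOfOrder α f) (hz : z ∈ ball (0 : ℂ) 1) :
    ‖f z‖ ≤ starlikeGrowth α ‖z‖ := by
  have hsum := (hasSum_nat_add_iff' 1).2 (hasSum_taylorCoeff hf.differentiableOn hz)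
  rw [Finset.sum_range_one, taylorCoeff_zero, hf.map_zero, zero_mul, sub_zero] at hsum
  rw [← hsum.tsum_eq]
  refine tsum_of_norm_bounded
    (hasSum_starlikeCoeffBound hf.lt_one ⟨norm_nonneg z, mem_ball_zero_iff.1 hz⟩) fun n => ?_
  rw [norm_mul, norm_pow]
  gcongr
  exact hf.norm_taylorCoeff_le n.succ_ne_zero

/-- The largest Bohr–Rogosinski sum of a function of the class `𝒮*(α)` on the circle `|z| = r`;
`radiusEquation_eq` compares it with the left-hand side of the equation for the radius. -/
noncomputable def starlikeMajorant (α : ℝ) (m N : ℕ) (r : ℝ) : ℝ :=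
  starlikeGrowth α (r ^ m) + ∑' j : ℕ, starlikeCoeffBound α (N + j) * r ^ (N + j)

theorem radiusEquation_eq (hα : α < 1) (m : ℕ) (hN : N ≠ 0) (hr : r ∈ Ico (0 : ℝ) 1) :
    radiusEquation α m N r = starlikeMajorant α m N r - 1 / (4 : ℝ) ^ (1 - α) := by
  rw [radiusEquation, starlikeMajorant, starlikeGrowth]
  rcases eq_or_ne N 1 with rfl | hN1
  · rw [(hasSum_starlikeCoeffBound_add hα hN hr).summable.tsum_eq_zero_add]
    simp only [if_true, starlikeCoeffBound_one, add_zero, pow_one, one_mul,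
      max_eq_right one_le_two, ← add_assoc, add_right_comm 1 _ 1, one_add_one_eq_two]
  · rw [if_neg hN1, max_eq_left (by omega : 2 ≤ N), add_zero]

theorem pow_mem_Ico_zero_one (hm : m ≠ 0) (hr : r ∈ Ico (0 : ℝ) 1) : r ^ m ∈ Ico (0 : ℝ) 1 :=
  ⟨pow_nonneg hr.1 m, pow_lt_one₀ hr.1 hr.2 hm⟩

theorem strictMonoOn_starlikeMajorant (hα : α < 1) (hm : m ≠ 0) (hN : N ≠ 0) :
    StrictMonoOn (starlikeMajorant α m N) (Ico 0 1) := by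
  intro s hs t ht hst
  refine add_lt_add_of_lt_of_le (strictMonoOn_starlikeGrowth hα (pow_mem_Ico_zero_one hm hs)
    (pow_mem_Ico_zero_one hm ht) (pow_lt_pow_left₀ hst hs.1 hm)) ?_
  refine (hasSum_starlikeCoeffBound_add hα hN hs).summable.tsum_le_tsum (fun j => ?_)
    (hasSum_starlikeCoeffBound_add hα hN ht).summable
  exact mul_le_mul_of_nonneg_left (pow_le_pow_left₀ hs.1 hst.le _)
    (starlikeCoeffBound_nonneg hα.le _)

theorem continuousOn_starlikeMajorant (hα : α < 1) (hm : m ≠ 0) (hN : N ≠ 0) :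
    ContinuousOn (starlikeMajorant α m N) (Ico 0 1) := by
  have hgrowth := (continuousOn_starlikeGrowth α).mono (Ico_subset_Iio_self (a := 0))
  refine (hgrowth.comp (by fun_prop) fun r => pow_mem_Ico_zero_one hm).add ?_
  exact (hgrowth.sub (by fun_prop)).congr fun r hr =>
    (hasSum_starlikeCoeffBound_add hα hN hr).tsum_eq

theorem starlikeMajorant_zero (α : ℝ) (hm : m ≠ 0) (hN : N ≠ 0) : starlikeMajorant α m N 0 = 0 := by
  simp [starlikeMajorant, starlikeGrowth, hm, hN]

theorem pow_le_starlikeMajorant (hα : α < 1) (hm : m ≠ 0) (N : ℕ) (hr : r ∈ Ico (0 : ℝ) 1) :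
    r ^ m ≤ starlikeMajorant α m N r :=
  le_add_of_le_of_nonneg (le_starlikeGrowth hα (pow_mem_Ico_zero_one hm hr))
    (tsum_nonneg fun _ => mul_nonneg (starlikeCoeffBound_nonneg hα.le _) (pow_nonneg hr.1 _))

theorem exists_starlikeMajorant_eq (hα : α < 1) (hm : m ≠ 0) (hN : N ≠ 0) {s : ℝ}
    (hs : s ∈ Ioo (0 : ℝ) 1) : ∃ r ∈ Ioo (0 : ℝ) 1, starlikeMajorant α m N r = s := by
  have hroot : s ^ (m : ℝ)⁻¹ ∈ Ico (0 : ℝ) 1 :=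
    ⟨Real.rpow_nonneg hs.1.le _, Real.rpow_lt_one hs.1.le hs.2 (by positivity)⟩
  have hzero := starlikeMajorant_zero α hm hN
  have hle : s ≤ starlikeMajorant α m N (s ^ (m : ℝ)⁻¹) := by
    simpa only [Real.rpow_inv_natCast_pow hs.1.le hm] using pow_le_starlikeMajorant hα hm N hroot
  obtain ⟨r, hr, rfl⟩ := intermediate_value_Icc hroot.1 ((continuousOn_starlikeMajorant hα hm
    hN).mono (Icc_subset_Ico_right hroot.2)) ⟨hzero.trans_le hs.1.le, hle⟩
  have hr0 : r ≠ 0 := fun h => hs.1.ne' (h ▸ hzero)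
  exact ⟨r, ⟨hr.1.lt_of_ne' hr0, hr.2.trans_lt hroot.2⟩, rfl⟩

theorem one_div_four_rpow_mem_Ioo (hα : α < 1) : 1 / (4 : ℝ) ^ (1 - α) ∈ Ioo (0 : ℝ) 1 :=
  ⟨by positivity, (div_lt_one (by positivity)).2
    (Real.one_lt_rpow (by norm_num) (sub_pos.2 hα))⟩

theorem IsStarlikeOfOrder.norm_taylorCoeff_mul_pow_le (hf : IsStarlikeOfOrder α f) (hN : N ≠ 0)
    (z : ℂ) (j : ℕ) : ‖taylorCoeff f (N + j)‖ * ‖z‖ ^ (N + j) ≤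
      starlikeCoeffBound α (N + j) * ‖z‖ ^ (N + j) := by
  gcongr
  exact hf.norm_taylorCoeff_le (by omega)

theorem IsStarlikeOfOrder.summable_norm_taylorCoeff (hf : IsStarlikeOfOrder α f) (hN : N ≠ 0)
    (hz : ‖z‖ < 1) : Summable fun j => ‖taylorCoeff f (N + j)‖ * ‖z‖ ^ (N + j) :=
  .of_nonneg_of_le (fun _ => by positivity) (hf.norm_taylorCoeff_mul_pow_le hN z)
    (hasSum_starlikeCoeffBound_add hf.lt_one hN ⟨norm_nonneg z, hz⟩).summable

theorem IsStarlikeOfOrder.bohrRogosinskiSum_le (hf : IsStarlikeOfOrder α f) (hm : m ≠ 0)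
    (hN : N ≠ 0) (hz : ‖z‖ < 1) : bohrRogosinskiSum f m N z ≤ starlikeMajorant α m N ‖z‖ := by
  have hzm := hf.norm_le (z := z ^ m) (by simpa using pow_lt_one₀ (norm_nonneg z) hz hm)
  rw [norm_pow] at hzm
  exact add_le_add hzm ((hf.summable_norm_taylorCoeff hN hz).tsum_le_tsum
    (hf.norm_taylorCoeff_mul_pow_le hN z)
    (hasSum_starlikeCoeffBound_add hf.lt_one hN ⟨norm_nonneg z, hz⟩).summable)

theorem bohrRogosinskiSum_starlikeExtremal (hα : α < 1) (hm : m ≠ 0) (hN : N ≠ 0)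
    (hr : r ∈ Ico (0 : ℝ) 1) :
    bohrRogosinskiSum (starlikeExtremal α) m N r = starlikeMajorant α m N r := by
  have hrm := pow_mem_Ico_zero_one hm hr
  rw [bohrRogosinskiSum, starlikeMajorant, ← Complex.ofReal_pow, starlikeExtremal_ofReal α hrm.2,
    Complex.norm_real, Complex.norm_real, Real.norm_of_nonneg hr.1,
    Real.norm_of_nonneg (hrm.1.trans (le_starlikeGrowth hα hrm))]
  congr! 3 with j
  rw [taylorCoeff_starlikeExtremal hα (by omega), Complex.norm_real,
    Real.norm_of_nonneg (starlikeCoeffBound_nonneg hα.le _)]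

end Majorant

theorem mainTheorem5 (α : ℝ) (hα0 : 0 ≤ α) (hα1 : α < 1) (m N : ℕ) (hm : 1 ≤ m) (hN : 1 ≤ N) :
    ∃ r₀ : ℝ,
      -- `r₀` is the smallest positive root of the equation
      IsLeast {r : ℝ | r ∈ Ioo (0 : ℝ) 1 ∧ radiusEquation α m N r = 0} r₀ ∧
      -- the inequality holds for every function of the class and `|z| ≤ r₀`
      (∀ f : ℂ → ℂ, IsStarlikeOfOrder α f → ∀ z : ℂ, ‖z‖ ≤ r₀ →
        Summable (fun j : ℕ => ‖taylorCoeff f (N + j)‖ * ‖z‖ ^ (N + j)) ∧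
        bohrRogosinskiSum f m N z ≤ distToBoundary f) ∧
      -- sharpness: some function of the class attains equality on `|z| = r₀`
      -- and violates the inequality on every larger circle in the disk
      (∃ f : ℂ → ℂ, IsStarlikeOfOrder α f ∧
        (∃ z : ℂ, ‖z‖ = r₀ ∧ bohrRogosinskiSum f m N z = distToBoundary f) ∧
        (∀ r : ℝ, r₀ < r → r < 1 →
          ∃ z : ℂ, ‖z‖ = r ∧ distToBoundary f < bohrRogosinskiSum f m N z)) := by
  have hm0 : m ≠ 0 := Nat.one_le_iff_ne_zero.1 hm
  have hN0 : N ≠ 0 := Nat.one_le_iff_ne_zero.1 hN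
  obtain ⟨r₀, hr₀, heq⟩ := exists_starlikeMajorant_eq hα1 hm0 hN0 (one_div_four_rpow_mem_Ioo hα1)
  have hmono := strictMonoOn_starlikeMajorant hα1 hm0 hN0
  have hmem : r₀ ∈ Ico (0 : ℝ) 1 := Ioo_subset_Ico_self hr₀
  have hdist := distToBoundary_starlikeExtremal hα0 hα1
  refine ⟨r₀, ⟨⟨hr₀, ?root⟩, ?least⟩, fun f hf z hz => ?bound, starlikeExtremal α,
    isStarlikeOfOrder_starlikeExtremal hα1, ⟨r₀, by simp [abs_of_pos hr₀.1], ?equality⟩, ?sharp⟩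
  case root => rw [radiusEquation_eq hα1 m hN0 hmem, heq, sub_self]
  case least =>
    rintro r ⟨hr, hroot⟩
    rw [radiusEquation_eq hα1 m hN0 (Ioo_subset_Ico_self hr), sub_eq_zero, ← heq] at hroot
    exact (hmono.injOn (Ioo_subset_Ico_self hr) hmem hroot).ge
  case bound =>
    have hz1 : ‖z‖ < 1 := hz.trans_lt hr₀.2
    exact ⟨hf.summable_norm_taylorCoeff hN0 hz1, (hf.bohrRogosinskiSum_le hm0 hN0 hz1).trans
      ((hmono.monotoneOn ⟨norm_nonneg z, hz1⟩ hmem hz).trans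
        (heq.trans_le (hf.le_distToBoundary hα0)))⟩
  case equality => rw [bohrRogosinskiSum_starlikeExtremal hα1 hm0 hN0 hmem, heq, hdist]
  case sharp =>
    intro r hr hr1
    have hr' : r ∈ Ico (0 : ℝ) 1 := ⟨(hr₀.1.trans hr).le, hr1⟩
    refine ⟨r, by simp [abs_of_nonneg hr'.1], ?_⟩
    simpa only [bohrRogosinskiSum_starlikeExtremal hα1 hm0 hN0 hr', hdist, heq] using
      hmono hmem hr' hr
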